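/- Proposition 2.5 (Reeb cone comparison). Let $T=(\mathbb C^*)^s$ act diagonally on $\mathbb C^N$, let $\mathfrak t=\mathrm{Lie}(T_{\mathbb R})\cong\mathbb R^s$ be the Lie algebra of its maximal compact subtorus $T_{\mathbb R}$, and let $Y\subset\mathbb C^N$ be an affine variety defined by a radical $T$-homogeneous ideal, smooth away from the origin and not contained in a proper linear subspace. Let $\mathcal H=\bigoplus_{\alpha\in\mathfrak t^*}\mathcal H_\alpha$ be the weight decomposition of its ring of regular functions, and call $\xi\in\mathfrak t$ a Reeb vector field if $\alpha(\xi)>0$ for every $\alpha\neq0$ with $\mathcal H_\alpha\ne0$; the algebraic Reeb cone $\mathcal C_R\subset\mathfrak t$ is the set of all such $\xi$. Identify $\xi\in\mathfrak t$ with the vector field it induces on $Y$. Let $\xi_0$ be a rational Reeb vector field, i.e. $\alpha(\lambda\xi_0)\in\mathbb N$ for some $\lambda>0$ and all $\alpha$ with $\mathcal H_\alpha\neq0$. Let $\Omega_0=\tfrac12 i\partial\bar\partial r^2$ be a Kähler metric on $Y\setminus\{0\}$ compatible with $\xi_0$: $r:Y\setminus\{0\}\to\mathbb R_{>0}$ is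 smooth and $\xi_0$-invariant, $\Omega_0$ is positive, and $\xi_0=J(r\partial_r)$, where $r\partial_r$ is the radial field of the cone metric $g_0=\Omega_0(\cdot,J\cdot)$, that is, $V=-J\xi_0$ satisfies $dr(V)=r$ and $g_0(V,\cdot)=r\,dr$. Assume moreover that $r$ is invariant under the whole compact torus $T_{\mathbb R}$. Let $\eta_0=r^{-2}g_0(\xi_0,\cdot)$ be the contact $1$-form dual to $\xi_0$. Then $$\{\xi\in\mathfrak t : \eta_0(\xi)>0\text{ on }Y\setminus\{0\}\}=\mathcal C_R,$$ and $\mathcal C_R$ is also the set of $\xi\in\mathfrak t$ acting with positive weight on all non-constant functions: $\alpha(\xi)>0$ whenever $\mathcal H_\alpha$ contains a non-constant function. -/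

import Mathlib

open scoped ContDiff

noncomputable section

namespace ReebCone

/-! ### The diagonal torus

The torus `T = (ℂˣ)ˢ` acts diagonally on `ℂᴺ`, the `i`-th coordinate function having weight
`W i ∈ ℤˢ`. The Lie algebra `𝔱` of the maximal compact subtorus `T_ℝ = U(1)ˢ` is `ℝˢ`, where
`ξ ∈ ℝˢ` has exponential `(exp (I ξ₁), …, exp (I ξₛ))`; the weights are elements of `ℤˢ ⊂ 𝔱*`. -/

/-- The character of `(ℂˣ)ˢ` with weight `α`: `t ↦ ∏ₖ tₖ ^ αₖ`. -/
def character {s : ℕ} (α : Fin s → ℤ) (t : Fin s → ℂˣ) : ℂ :=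
  ((∏ k, t k ^ α k : ℂˣ) : ℂ)

/-- The pairing `α(ξ)` of a weight `α` with a vector `ξ ∈ 𝔱 = ℝˢ`. -/
def pairing {s : ℕ} (α : Fin s → ℤ) (ξ : Fin s → ℝ) : ℝ :=
  ∑ k, (α k : ℝ) * ξ k

/-- The action of `t ∈ T` on polynomials: `(t · P)(x) = P (t x)`, i.e. `Xᵢ ↦ χ_{W i}(t) Xᵢ`. -/
def polyAction {N s : ℕ} (W : Fin N → Fin s → ℤ) (t : Fin s → ℂˣ) :
    MvPolynomial (Fin N) ℂ →ₐ[ℂ] MvPolynomial (Fin N) ℂ :=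
  MvPolynomial.aeval fun i => MvPolynomial.C (character (W i) t) * MvPolynomial.X i

/-- An affine variety `Y ⊂ ℂᴺ` given by a radical ideal that is preserved by a diagonal torus
action, smooth away from the origin and not contained in a proper linear subspace. -/
structure TorusVariety (N s : ℕ) where
  /-- the weights of the coordinate functions under the torus -/
  weight : Fin N → Fin s → ℤ
  /-- the ideal of the variety -/
  ideal : Ideal (MvPolynomial (Fin N) ℂ)
  isRadical : ideal.IsRadical
  stable : ∀ t : Fin s → ℂˣ, ideal ≤ ideal.comap (polyAction weight t)
  smooth : ∀ q : PrimeSpectrum (MvPolynomial (Fin N) ℂ ⧸ ideal),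
    q.comap (Ideal.Quotient.mk ideal) ≠ MvPolynomial.pointToPoint (0 : Fin N → ℂ) →
      q ∈ Algebra.smoothLocus ℂ (MvPolynomial (Fin N) ℂ ⧸ ideal)
  nondegenerate : ∀ V : Submodule ℂ (Fin N → ℂ),
    MvPolynomial.zeroLocus ℂ ideal ⊆ (V : Set (Fin N → ℂ)) → V = ⊤

namespace TorusVariety

variable {N s : ℕ} (Y : TorusVariety N s)

/-- The points of `Y`. -/
def points : Set (Fin N → ℂ) := MvPolynomial.zeroLocus ℂ Y.ideal

/-- The points of `Y ∖ {0}`. -/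
def puncturedPoints : Set (Fin N → ℂ) := Y.points \ {0}

/-! ### The algebraic Reeb cone -/

/-- The ring `ℋ` of regular functions on `Y`. -/
abbrev coordRing : Type := MvPolynomial (Fin N) ℂ ⧸ Y.ideal

/-- The action of `t ∈ T` on regular functions, `(t · f)(x) = f (t x)`. -/
def funAction (t : Fin s → ℂˣ) : Y.coordRing →ₐ[ℂ] Y.coordRing :=
  Ideal.quotientMapₐ Y.ideal (polyAction Y.weight t) (Y.stable t)

/-- The weight space `ℋ_α`: the regular functions `f` with `t · f = χ_α(t) f` for all `t ∈ T`. -/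
def weightSpace (α : Fin s → ℤ) : Submodule ℂ Y.coordRing :=
  ⨅ t : Fin s → ℂˣ, Module.End.eigenspace (Y.funAction t).toLinearMap (character α t)

/-- `ξ ∈ 𝔱` is a Reeb vector field: `α(ξ) > 0` whenever `α ≠ 0` and `ℋ_α ≠ 0`. -/
def IsReeb (ξ : Fin s → ℝ) : Prop :=
  ∀ α : Fin s → ℤ, α ≠ 0 → Y.weightSpace α ≠ ⊥ → 0 < pairing α ξ

/-- The algebraic Reeb cone. -/
def reebCone : Set (Fin s → ℝ) := {ξ | Y.IsReeb ξ}

/-- The vectors `ξ ∈ 𝔱` that act with positive weights on the non-constant functions. -/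
def positiveWeightCone : Set (Fin s → ℝ) :=
  {ξ | ∀ α : Fin s → ℤ, ∀ f ∈ Y.weightSpace α,
    f ∉ Set.range (algebraMap ℂ Y.coordRing) → 0 < pairing α ξ}

/-- `ξ ∈ 𝔱` is rational: some positive multiple pairs with all weights of `ℋ` to natural
numbers. -/
def IsRational (ξ : Fin s → ℝ) : Prop :=
  ∃ c : ℝ, 0 < c ∧ ∀ α : Fin s → ℤ, Y.weightSpace α ≠ ⊥ → ∃ n : ℕ, pairing α (c • ξ) = n

/-! ### Vector fields induced by the torus -/

/-- The action of `exp ξ ∈ T_ℝ` on `ℂᴺ`. -/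
def expAction (ξ : Fin s → ℝ) (x : Fin N → ℂ) : Fin N → ℂ :=
  fun i => Complex.exp (Complex.I * (pairing (Y.weight i) ξ : ℂ)) * x i

/-- The value at `x` of the vector field on `ℂᴺ` (tangent to `Y`) induced by `ξ ∈ 𝔱`. -/
def vectorField (ξ : Fin s → ℝ) (x : Fin N → ℂ) : Fin N → ℂ :=
  fun i => Complex.I * (pairing (Y.weight i) ξ : ℂ) * x i

/-- The vector field of `ξ` is the velocity field of the action of `exp (τ ξ)`. -/
theorem hasDerivAt_expAction (ξ : Fin s → ℝ) (x : Fin N → ℂ) :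
    HasDerivAt (fun τ : ℝ => Y.expAction (τ • ξ) x) (Y.vectorField ξ x) 0 := by
  rw [hasDerivAt_pi]
  intro i
  have hp : ∀ τ : ℝ, pairing (Y.weight i) (τ • ξ) = τ * pairing (Y.weight i) ξ := by
    intro τ
    simp only [pairing, Pi.smul_apply, smul_eq_mul, Finset.mul_sum]
    exact Finset.sum_congr rfl fun k _ => by ring
  simp only [expAction, vectorField, hp]
  have h1 : HasDerivAt (fun τ : ℝ => (τ : ℂ)) 1 0 := Complex.ofRealCLM.hasDerivAt
  have h2 := (((h1.mul_const (pairing (Y.weight i) ξ : ℂ)).const_mul Complex.I).cexp).mul_const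
    (x i)
  simpa using h2

/-! ### Kähler cone metrics

The punctured variety `Y ∖ {0}` is a closed complex submanifold of `ℂᴺ ∖ {0}`, with complex
structure `J` = multiplication by `I`. A smooth function on it is the restriction of a function
smooth on a neighbourhood of `Y ∖ {0}` in `ℂᴺ`, and `∂∂̄` and `d` commute with this restriction;
so forms on `Y ∖ {0}` are computed from such an extension, evaluated on tangent vectors of `Y`. -/

/-- The tangent space of `Y` at `p`. -/
def tangentSpace (p : Fin N → ℂ) : Set (Fin N → ℂ) :=
  {v | ∀ P ∈ Y.ideal, ∑ i, MvPolynomial.eval p (MvPolynomial.pderiv i P) * v i = 0}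

end TorusVariety

/-- The `2`-form `i∂∂̄ψ = ½ d(dᶜψ)`, where `dᶜψ(v) = -dψ(Jv)`. -/
def iDDbar {N : ℕ} (ψ : (Fin N → ℂ) → ℝ) (p v w : Fin N → ℂ) : ℝ :=
  (fderiv ℝ (fderiv ℝ ψ) p (Complex.I • v) w - fderiv ℝ (fderiv ℝ ψ) p v (Complex.I • w)) / 2

/-- The form `Ω = ½ i∂∂̄ r²`. -/
def kahlerForm {N : ℕ} (r : (Fin N → ℂ) → ℝ) (p v w : Fin N → ℂ) : ℝ :=
  iDDbar (fun x => r x ^ 2) p v w / 2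

/-- The symmetric form `g(v, w) = Ω(v, Jw)`. -/
def kahlerMetric {N : ℕ} (r : (Fin N → ℂ) → ℝ) (p v w : Fin N → ℂ) : ℝ :=
  kahlerForm r p v (Complex.I • w)

namespace TorusVariety

variable {N s : ℕ} (Y : TorusVariety N s)

/-- The function `r` defines a Kähler metric `Ω = ½ i∂∂̄ r²` on `Y ∖ {0}` that is compatible with
`ξ`: it is smooth, positive and `ξ`-invariant, `Ω` is positive, and `ξ = J (r ∂_r)`, i.e. `-J ξ`
is the radial field `r ∂_r` of the cone metric: `dr (r ∂_r) = r` and `g (r ∂_r, ·) = r dr`. -/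
structure IsCompatible (ξ : Fin s → ℝ) (r : (Fin N → ℂ) → ℝ) : Prop where
  smooth : ∀ p ∈ Y.puncturedPoints, ContDiffAt ℝ ∞ r p
  pos : ∀ p ∈ Y.puncturedPoints, 0 < r p
  invariant : ∀ p ∈ Y.puncturedPoints, ∀ τ : ℝ, r (Y.expAction (τ • ξ) p) = r p
  kahler : ∀ p ∈ Y.puncturedPoints, ∀ v ∈ Y.tangentSpace p, v ≠ 0 → 0 < kahlerMetric r p v v
  radial : ∀ p ∈ Y.puncturedPoints, fderiv ℝ r p (-(Complex.I • Y.vectorField ξ p)) = r p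
  gradient : ∀ p ∈ Y.puncturedPoints, ∀ v ∈ Y.tangentSpace p,
    kahlerMetric r p (-(Complex.I • Y.vectorField ξ p)) v = r p * fderiv ℝ r p v

/-- The function `r` on `Y ∖ {0}` is invariant under the compact torus `T_ℝ`. -/
def IsTorusInvariant (r : (Fin N → ℂ) → ℝ) : Prop :=
  ∀ p ∈ Y.puncturedPoints, ∀ ξ : Fin s → ℝ, r (Y.expAction ξ p) = r p

/-- The contact form dual to `ξ₀`: `η₀ = r⁻² g(ξ₀, ·)` on `Y ∖ {0}`. -/
def contactForm (ξ₀ : Fin s → ℝ) (r : (Fin N → ℂ) → ℝ) (p v : Fin N → ℂ) : ℝ :=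
  kahlerMetric r p (Y.vectorField ξ₀ p) v / r p ^ 2

/-- The differential-geometric Reeb cone: all `ξ ∈ 𝔱` with `η₀(ξ) > 0` on `Y ∖ {0}`. -/
def contactReebCone (ξ₀ : Fin s → ℝ) (r : (Fin N → ℂ) → ℝ) : Set (Fin s → ℝ) :=
  {ξ | ∀ p ∈ Y.puncturedPoints, 0 < Y.contactForm ξ₀ r p (Y.vectorField ξ p)}

end TorusVariety

end ReebCone

end

/-!
Write `V_ξ = -J ξ` for the vector field `x ↦ (αᵢ(ξ) xᵢ)` on `ℂᴺ`, where `αᵢ` is the weight of the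
`i`-th coordinate. It is tangent to `Y`, its flow is the action of `exp (τ ξ) ∈ T`, and a function
`f ∈ ℋ_α` satisfies `f (exp (τ ξ) x) = exp (τ α(ξ)) f(x)`. The gradient condition on the cone metric
gives `η₀(ξ) = dr(V_ξ) / r`, so everything is about the growth of `r` along the flow of `V_ξ`.

The radial field `V_ξ₀` vanishes nowhere on `Y ∖ {0}`. Hence no coordinate has weight zero, every
Reeb vector field has positive weight on every coordinate, and its backward flow contracts `Y` to
the origin. In particular a function of weight zero is constant, which identifies the Reeb cone with
the cone of positive weights on non-constant functions. Also `r` is homogeneous of degree one under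
`V_ξ₀`, as is the gauge `maxᵢ |xᵢ| ^ (1 / αᵢ(ξ₀))`, so the two are comparable
(`IsCompatible.exists_gauge_bounds`): `r` tends to `0` exactly at the origin.

* If `η₀(ξ) > 0` on `Y ∖ {0}`, then `η₀(ξ) ≥ δ > 0`, because `η₀(ξ)` is invariant under the flow of
  `V_ξ₀`, which has a compact cross-section. So `r` decays exponentially along the backward flow of
  `V_ξ`, which therefore converges to the origin. A function `f ∈ ℋ_α` with `α ≠ 0` vanishes there,
  and this forces `α(ξ) > 0` (`IsCompatible.contactReebCone_subset`).
* If `ξ` is Reeb, then `r²` is convex along the flow lines of `V_ξ`: it is `ξ`-invariant, so its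
  second derivative is its Laplacian along a complex orbit, namely `4 g(V_ξ, V_ξ)`
  (`IsCompatible.hessian_sq_radialField`). It is positive and tends to `0` along the backward flow,
  so it has positive derivative (`IsCompatible.reebCone_subset`).
-/

namespace ReebCone

open Filter Topology

/-! ### Torus characters, polynomials along curves and the metric -/

theorem pairing_smul {s : ℕ} (α : Fin s → ℤ) (c : ℝ) (ξ : Fin s → ℝ) :
    pairing α (c • ξ) = c * pairing α ξ := by
  simp only [pairing, Pi.smul_apply, smul_eq_mul, Finset.mul_sum]
  exact Finset.sum_congr rfl fun k _ => by ring

theorem pairing_zero {s : ℕ} (ξ : Fin s → ℝ) : pairing (0 : Fin s → ℤ) ξ = 0 := by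
  simp [pairing]

/-- The element `exp (z ξ)` of the complex torus. -/
noncomputable def torusExp {s : ℕ} (ξ : Fin s → ℝ) (z : ℂ) : Fin s → ℂˣ :=
  fun k => Units.mk0 (Complex.exp (z * ξ k)) (Complex.exp_ne_zero _)

theorem character_torusExp {s : ℕ} (α : Fin s → ℤ) (ξ : Fin s → ℝ) (z : ℂ) :
    character α (torusExp ξ z) = Complex.exp (z * pairing α ξ) := by
  simp only [character, torusExp, pairing, Units.coe_prod, Units.val_zpow_eq_zpow_val,
    Units.val_mk0, ← Complex.exp_int_mul, ← Complex.exp_sum]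
  congr 1
  push_cast
  rw [Finset.mul_sum]
  exact Finset.sum_congr rfl fun k _ => by ring

theorem eval_polyAction {N s : ℕ} (W : Fin N → Fin s → ℤ) (t : Fin s → ℂˣ)
    (P : MvPolynomial (Fin N) ℂ) (x : Fin N → ℂ) :
    MvPolynomial.eval x (polyAction W t P) =
      MvPolynomial.eval (fun i => character (W i) t * x i) P := by
  induction P using MvPolynomial.induction_on with
  | C a => simp [polyAction]
  | add p q hp hq => simp only [map_add, hp, hq]
  | mul_X p i hp =>
    simp only [map_mul, hp, MvPolynomial.eval_X]
    simp [polyAction]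

/-- The chain rule for a polynomial along a curve, in terms of formal partial derivatives. -/
theorem hasDerivAt_eval {N : ℕ} {c : ℝ → Fin N → ℂ} {c' : Fin N → ℂ} {t : ℝ}
    (hc : HasDerivAt c c' t) (P : MvPolynomial (Fin N) ℂ) :
    HasDerivAt (fun τ => MvPolynomial.eval (c τ) P)
      (∑ i, MvPolynomial.eval (c t) (MvPolynomial.pderiv i P) * c' i) t := by
  induction P using MvPolynomial.induction_on with
  | C a => simpa using hasDerivAt_const t a
  | add p q hp hq =>
    simpa only [map_add, add_mul, Finset.sum_add_distrib] using hp.fun_add hq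
  | mul_X p j hp =>
    have h := hp.mul (hasDerivAt_pi.1 hc j)
    simp only [map_mul, MvPolynomial.eval_X]
    refine h.congr_deriv ?_
    simp only [Derivation.leibniz, MvPolynomial.pderiv_X, smul_eq_mul, map_add, map_mul,
      MvPolynomial.eval_X, add_mul, Finset.sum_add_distrib, Pi.single_apply]
    rw [add_comm, Finset.sum_mul]
    congr 1
    · rw [Finset.sum_eq_single j]
      · simp
      · intro b _ hb
        simp [hb.symm]
      · simp
    · exact Finset.sum_congr rfl fun k _ => by ring

/-- `g` is invariant under the complex structure. -/
theorem kahlerMetric_eq {N : ℕ} (r : (Fin N → ℂ) → ℝ) (p v w : Fin N → ℂ) :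
    kahlerMetric r p v w =
      (fderiv ℝ (fderiv ℝ fun x => r x ^ 2) p (Complex.I • v) (Complex.I • w) +
        fderiv ℝ (fderiv ℝ fun x => r x ^ 2) p v w) / 4 := by
  have h : Complex.I • Complex.I • w = -w := by
    rw [smul_smul, Complex.I_mul_I, neg_one_smul]
  simp only [kahlerMetric, kahlerForm, iDDbar, h, map_neg]
  ring

theorem kahlerMetric_neg_I_smul {N : ℕ} (r : (Fin N → ℂ) → ℝ) (p v w : Fin N → ℂ) :
    kahlerMetric r p (-(Complex.I • v)) (-(Complex.I • w)) = kahlerMetric r p v w := by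
  have h (u : Fin N → ℂ) : Complex.I • Complex.I • u = -u := by
    rw [smul_smul, Complex.I_mul_I, neg_one_smul]
  simp only [kahlerMetric_eq, smul_neg, h, map_neg, neg_neg, neg_apply]
  ring

namespace TorusVariety

variable {N s : ℕ} (Y : TorusVariety N s)

/-! ### The complexified flow of a vector of the Lie algebra -/

/-- The action of `exp (z ξ) ∈ T` on `ℂᴺ`, for a complex time `z`. -/
noncomputable def complexFlow (ξ : Fin s → ℝ) (z : ℂ) (x : Fin N → ℂ) : Fin N → ℂ :=
  fun i => Complex.exp (z * pairing (Y.weight i) ξ) * x i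

/-- The vector field `-J ξ`, the velocity field of `complexFlow ξ` in real time. -/
noncomputable def radialField (ξ : Fin s → ℝ) (x : Fin N → ℂ) : Fin N → ℂ :=
  fun i => pairing (Y.weight i) ξ * x i

theorem neg_I_smul_vectorField (ξ : Fin s → ℝ) (x : Fin N → ℂ) :
    -(Complex.I • Y.vectorField ξ x) = Y.radialField ξ x := by
  funext i
  simp only [vectorField, radialField, Pi.neg_apply, Pi.smul_apply, smul_eq_mul, ← mul_assoc,
    Complex.I_mul_I]
  ring

theorem expAction_smul (ξ : Fin s → ℝ) (θ : ℝ) (x : Fin N → ℂ) :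
    Y.expAction (θ • ξ) x = Y.complexFlow ξ (Complex.I * θ) x := by
  funext i
  simp only [expAction, complexFlow, pairing_smul]
  push_cast
  ring_nf

@[simp]
theorem complexFlow_zero (ξ : Fin s → ℝ) (x : Fin N → ℂ) : Y.complexFlow ξ 0 x = x := by
  funext i
  simp [complexFlow]

theorem complexFlow_add (ξ : Fin s → ℝ) (z w : ℂ) (x : Fin N → ℂ) :
    Y.complexFlow ξ (z + w) x = Y.complexFlow ξ z (Y.complexFlow ξ w x) := by
  funext i
  simp only [complexFlow, add_mul, Complex.exp_add, mul_assoc]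

theorem complexFlow_comm (ξ ζ : Fin s → ℝ) (z w : ℂ) (x : Fin N → ℂ) :
    Y.complexFlow ξ z (Y.complexFlow ζ w x) = Y.complexFlow ζ w (Y.complexFlow ξ z x) := by
  funext i
  simp only [complexFlow]
  ring

theorem complexFlow_ne_zero (ξ : Fin s → ℝ) (z : ℂ) {x : Fin N → ℂ} (hx : x ≠ 0) :
    Y.complexFlow ξ z x ≠ 0 := by
  obtain ⟨i, hi⟩ := Function.ne_iff.1 hx
  exact Function.ne_iff.2 ⟨i, mul_ne_zero (Complex.exp_ne_zero _) hi⟩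

theorem hasDerivAt_complexFlow (ξ : Fin s → ℝ) (a : ℂ) (x : Fin N → ℂ) (t : ℝ) :
    HasDerivAt (fun τ : ℝ => Y.complexFlow ξ (a * τ) x)
      (a • Y.radialField ξ (Y.complexFlow ξ (a * t) x)) t := by
  rw [hasDerivAt_pi]
  intro i
  have h1 : HasDerivAt (fun τ : ℝ => (τ : ℂ)) 1 t := Complex.ofRealCLM.hasDerivAt
  have h2 := (((h1.const_mul a).mul_const (pairing (Y.weight i) ξ : ℂ)).cexp).mul_const (x i)
  refine h2.congr_deriv ?_
  simp only [radialField, complexFlow, Pi.smul_apply, smul_eq_mul]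
  ring

theorem hasDerivAt_complexFlow_real (ξ : Fin s → ℝ) (x : Fin N → ℂ) (t : ℝ) :
    HasDerivAt (fun τ : ℝ => Y.complexFlow ξ τ x)
      (Y.radialField ξ (Y.complexFlow ξ t x)) t := by
  simpa using Y.hasDerivAt_complexFlow ξ 1 x t

/-- Differentiating the velocity field along its own flow. -/
theorem hasDerivAt_radialField_complexFlow (ξ : Fin s → ℝ) (a : ℂ) (x : Fin N → ℂ) (t : ℝ) :
    HasDerivAt (fun τ : ℝ => Y.radialField ξ (Y.complexFlow ξ (a * τ) x))
      (a • Y.radialField ξ (Y.radialField ξ (Y.complexFlow ξ (a * t) x))) t := by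
  rw [hasDerivAt_pi]
  intro i
  have h := (hasDerivAt_pi.1 (Y.hasDerivAt_complexFlow ξ a x t) i).const_mul
    (pairing (Y.weight i) ξ : ℂ)
  refine h.congr_deriv ?_
  simp only [radialField, Pi.smul_apply, smul_eq_mul]
  ring

theorem mem_points_iff {x : Fin N → ℂ} :
    x ∈ Y.points ↔ ∀ P ∈ Y.ideal, MvPolynomial.eval x P = 0 := by
  simp [points, MvPolynomial.aeval_eq_eval]

theorem eval_polyAction_torusExp (ξ : Fin s → ℝ) (z : ℂ) (P : MvPolynomial (Fin N) ℂ)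
    (x : Fin N → ℂ) :
    MvPolynomial.eval x (polyAction Y.weight (torusExp ξ z) P) =
      MvPolynomial.eval (Y.complexFlow ξ z x) P := by
  rw [eval_polyAction]
  simp only [character_torusExp]
  rfl

theorem complexFlow_mem_points (ξ : Fin s → ℝ) (z : ℂ) {x : Fin N → ℂ} (hx : x ∈ Y.points) :
    Y.complexFlow ξ z x ∈ Y.points := by
  rw [mem_points_iff] at hx ⊢
  intro P hP
  rw [← eval_polyAction_torusExp]
  exact hx _ (Y.stable _ hP)

theorem complexFlow_mem_puncturedPoints (ξ : Fin s → ℝ) (z : ℂ) {x : Fin N → ℂ}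
    (hx : x ∈ Y.puncturedPoints) : Y.complexFlow ξ z x ∈ Y.puncturedPoints :=
  ⟨Y.complexFlow_mem_points ξ z hx.1, Y.complexFlow_ne_zero ξ z hx.2⟩

theorem radialField_mem_tangentSpace (ξ : Fin s → ℝ) {x : Fin N → ℂ} (hx : x ∈ Y.points) :
    Y.radialField ξ x ∈ Y.tangentSpace x := by
  intro P hP
  have h := hasDerivAt_eval (Y.hasDerivAt_complexFlow_real ξ x 0) P
  simp only [Complex.ofReal_zero, complexFlow_zero] at h
  refine h.unique ?_
  have h0 : (fun τ : ℝ => MvPolynomial.eval (Y.complexFlow ξ τ x) P) = fun _ => 0 := by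
    funext τ
    exact Y.mem_points_iff.1 (Y.complexFlow_mem_points ξ τ hx) P hP
  rw [h0]
  exact hasDerivAt_const 0 0

theorem isClosed_points : IsClosed Y.points := by
  have : Y.points = ⋂ P ∈ Y.ideal, {x | MvPolynomial.eval x P = 0} := by
    ext x
    simp [mem_points_iff]
  rw [this]
  exact isClosed_biInter fun P _ =>
    isClosed_eq (MvPolynomial.continuous_eval P) continuous_const

/-! ### Weight vectors as functions on `Y` -/

/-- The Nullstellensatz for the radical ideal of `Y`. -/
theorem mem_ideal_iff {P : MvPolynomial (Fin N) ℂ} :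
    P ∈ Y.ideal ↔ ∀ x ∈ Y.points, MvPolynomial.eval x P = 0 := by
  conv_lhs => rw [← Y.isRadical.radical,
    ← MvPolynomial.vanishingIdeal_zeroLocus_eq_radical (K := ℂ),
    MvPolynomial.mem_vanishingIdeal_iff]
  simp only [points, MvPolynomial.aeval_eq_eval]

theorem mk_mem_weightSpace_iff {α : Fin s → ℤ} {P : MvPolynomial (Fin N) ℂ} :
    Ideal.Quotient.mk Y.ideal P ∈ Y.weightSpace α ↔
      ∀ t : Fin s → ℂˣ, polyAction Y.weight t P - character α t • P ∈ Y.ideal := by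
  simp only [weightSpace, Submodule.mem_iInf, Module.End.mem_eigenspace_iff]
  refine forall_congr' fun t => ?_
  rw [← Ideal.Quotient.eq]
  rfl

theorem eval_complexFlow_of_mem_weightSpace {α : Fin s → ℤ} {P : MvPolynomial (Fin N) ℂ}
    (hP : Ideal.Quotient.mk Y.ideal P ∈ Y.weightSpace α) (ξ : Fin s → ℝ) (z : ℂ)
    {x : Fin N → ℂ} (hx : x ∈ Y.points) :
    MvPolynomial.eval (Y.complexFlow ξ z x) P =
      Complex.exp (z * pairing α ξ) * MvPolynomial.eval x P := by
  have h := Y.mem_points_iff.1 hx _ (Y.mk_mem_weightSpace_iff.1 hP (torusExp ξ z))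
  rwa [map_sub, eval_polyAction_torusExp, MvPolynomial.smul_eval, character_torusExp,
    sub_eq_zero] at h

theorem mk_X_mem_weightSpace (i : Fin N) :
    Ideal.Quotient.mk Y.ideal (MvPolynomial.X i) ∈ Y.weightSpace (Y.weight i) := by
  rw [mk_mem_weightSpace_iff]
  intro t
  simp [polyAction, MvPolynomial.C_mul']

/-- No coordinate function vanishes on `Y`. -/
theorem exists_apply_ne_zero (i : Fin N) : ∃ x ∈ Y.points, x i ≠ 0 := by
  by_contra! h
  have hV := Y.nondegenerate (LinearMap.ker (LinearMap.proj (R := ℂ) (φ := fun _ => ℂ) i))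
    fun x hx => h x hx
  have : (Pi.single i 1 : Fin N → ℂ) ∈
      LinearMap.ker (LinearMap.proj (R := ℂ) (φ := fun _ => ℂ) i) := by
    rw [hV]
    trivial
  simp at this

theorem weightSpace_weight_ne_bot (i : Fin N) : Y.weightSpace (Y.weight i) ≠ ⊥ := by
  intro h
  have h1 := Y.mk_X_mem_weightSpace i
  rw [h, Submodule.mem_bot, Ideal.Quotient.eq_zero_iff_mem, mem_ideal_iff] at h1
  obtain ⟨x, hx, hxi⟩ := Y.exists_apply_ne_zero i
  exact hxi (by simpa using h1 x hx)

/-- A nonzero weight vector is represented by a polynomial that is nonzero at a point of `Y`. -/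
theorem exists_eval_ne_zero {α : Fin s → ℤ} (h : Y.weightSpace α ≠ ⊥) :
    ∃ P, Ideal.Quotient.mk Y.ideal P ∈ Y.weightSpace α ∧
      ∃ x ∈ Y.points, MvPolynomial.eval x P ≠ 0 := by
  obtain ⟨f, hf, hf0⟩ := Submodule.exists_mem_ne_zero_of_ne_bot h
  obtain ⟨P, rfl⟩ := Ideal.Quotient.mk_surjective f
  refine ⟨P, hf, ?_⟩
  by_contra! hP
  exact hf0 (Ideal.Quotient.eq_zero_iff_mem.2 (Y.mem_ideal_iff.2 hP))

/-! ### Positivity of the weights of the coordinates -/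

theorem tendsto_cexp_mul_atBot {a : ℝ} (ha : 0 < a) :
    Tendsto (fun τ : ℝ => Complex.exp (τ * a)) atBot (𝓝 0) := by
  have h : Tendsto (fun τ : ℝ => ((Real.exp (τ * a) : ℝ) : ℂ)) atBot (𝓝 ((0 : ℝ) : ℂ)) :=
    (Complex.continuous_ofReal.tendsto 0).comp
      (Real.tendsto_exp_atBot.comp (tendsto_id.atBot_mul_const ha))
  simpa using h

theorem tendsto_complexFlow_atBot {ξ : Fin s → ℝ} (h : ∀ i, 0 ≤ pairing (Y.weight i) ξ)
    (x : Fin N → ℂ) :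
    Tendsto (fun τ : ℝ => Y.complexFlow ξ τ x) atBot
      (𝓝 fun i => if pairing (Y.weight i) ξ = 0 then x i else 0) := by
  rw [tendsto_pi_nhds]
  intro i
  by_cases h0 : pairing (Y.weight i) ξ = 0
  · simp [complexFlow, h0]
  · simpa [complexFlow, h0] using
      (tendsto_cexp_mul_atBot ((h i).lt_of_ne' h0)).mul_const (x i)

theorem tendsto_complexFlow_atBot_zero {ξ : Fin s → ℝ} (h : ∀ i, 0 < pairing (Y.weight i) ξ)
    (x : Fin N → ℂ) : Tendsto (fun τ : ℝ => Y.complexFlow ξ τ x) atBot (𝓝 0) := by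
  have := Y.tendsto_complexFlow_atBot (fun i => (h i).le) x
  simp only [(h _).ne', if_false] at this
  exact this

variable {Y} {ξ₀ ξ : Fin s → ℝ} {r : (Fin N → ℂ) → ℝ}

/-- The radial field vanishes nowhere on `Y ∖ {0}`, whereas a coordinate of weight zero would
leave a nonzero limit, fixed by the flow, at the negative end of a flow line. -/
theorem IsCompatible.weight_ne_zero (hr : Y.IsCompatible ξ₀ r) (hξ₀ : Y.IsReeb ξ₀) (i : Fin N) :
    Y.weight i ≠ 0 := by
  intro hi
  have hnonneg (j : Fin N) : 0 ≤ pairing (Y.weight j) ξ₀ := by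
    by_cases hj : Y.weight j = 0
    · rw [hj, pairing_zero]
    · exact (hξ₀ _ hj (Y.weightSpace_weight_ne_bot j)).le
  obtain ⟨x, hx, hxi⟩ := Y.exists_apply_ne_zero i
  have hlim := Y.tendsto_complexFlow_atBot hnonneg x
  set q : Fin N → ℂ := fun j => if pairing (Y.weight j) ξ₀ = 0 then x j else 0 with hq
  have hqY : q ∈ Y.puncturedPoints := by
    refine ⟨Y.isClosed_points.mem_of_tendsto hlim
      (Eventually.of_forall fun τ => Y.complexFlow_mem_points ξ₀ τ hx), ?_⟩
    refine Function.ne_iff.2 ⟨i, ?_⟩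
    simpa [hq, hi, pairing_zero] using hxi
  have hfix : Y.radialField ξ₀ q = 0 := by
    funext j
    by_cases hj : pairing (Y.weight j) ξ₀ = 0 <;> simp [radialField, hq, hj]
  have h := hr.radial q hqY
  rw [neg_I_smul_vectorField, hfix, map_zero] at h
  exact (hr.pos q hqY).ne h

theorem IsCompatible.pairing_weight_pos (hr : Y.IsCompatible ξ₀ r) (hξ₀ : Y.IsReeb ξ₀)
    (hξ : Y.IsReeb ξ) (i : Fin N) : 0 < pairing (Y.weight i) ξ :=
  hξ _ (hr.weight_ne_zero hξ₀ i) (Y.weightSpace_weight_ne_bot i)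

theorem tendsto_eval_complexFlow (h : ∀ i, 0 < pairing (Y.weight i) ξ) (x : Fin N → ℂ)
    (P : MvPolynomial (Fin N) ℂ) :
    Tendsto (fun τ : ℝ => MvPolynomial.eval (Y.complexFlow ξ τ x) P) atBot
      (𝓝 (MvPolynomial.eval 0 P)) :=
  ((MvPolynomial.continuous_eval P).tendsto 0).comp (Y.tendsto_complexFlow_atBot_zero h x)

theorem eval_zero_of_mem_weightSpace (h : ∀ i, 0 < pairing (Y.weight i) ξ) {α : Fin s → ℤ}
    (hα : 0 < pairing α ξ) {P : MvPolynomial (Fin N) ℂ}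
    (hP : Ideal.Quotient.mk Y.ideal P ∈ Y.weightSpace α) {x : Fin N → ℂ} (hx : x ∈ Y.points) :
    MvPolynomial.eval 0 P = 0 := by
  refine tendsto_nhds_unique (tendsto_eval_complexFlow h x P) ?_
  simpa only [Y.eval_complexFlow_of_mem_weightSpace hP ξ _ hx, zero_mul] using
    (tendsto_cexp_mul_atBot hα).mul_const (MvPolynomial.eval x P)

/-- A regular function of weight zero is constant: it is constant along the flow lines of a
contracting flow, all of which end at the origin. -/
theorem mem_range_algebraMap_of_mem_weightSpace_zero (h : ∀ i, 0 < pairing (Y.weight i) ξ)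
    {f : Y.coordRing} (hf : f ∈ Y.weightSpace 0) :
    f ∈ Set.range (algebraMap ℂ Y.coordRing) := by
  obtain ⟨P, rfl⟩ := Ideal.Quotient.mk_surjective f
  refine ⟨MvPolynomial.eval 0 P, ?_⟩
  change Ideal.Quotient.mk Y.ideal (MvPolynomial.C (MvPolynomial.eval 0 P)) = _
  rw [Ideal.Quotient.eq, mem_ideal_iff]
  intro x hx
  have hconst : MvPolynomial.eval 0 P = MvPolynomial.eval x P := by
    refine tendsto_nhds_unique (tendsto_eval_complexFlow h x P) ?_
    simp [Y.eval_complexFlow_of_mem_weightSpace hf ξ _ hx, pairing_zero]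
  rw [map_sub, MvPolynomial.eval_C, hconst, sub_self]

theorem reebCone_eq_positiveWeightCone (hr : Y.IsCompatible ξ₀ r) (hξ₀ : Y.IsReeb ξ₀) :
    Y.reebCone = Y.positiveWeightCone := by
  ext ξ
  constructor
  · intro hξ α f hf hconst
    by_cases hα : α = 0
    · subst hα
      exact absurd (mem_range_algebraMap_of_mem_weightSpace_zero
        (hr.pairing_weight_pos hξ₀ hξ₀) hf) hconst
    · refine hξ α hα fun hbot => hconst ?_
      rw [hbot, Submodule.mem_bot] at hf
      exact ⟨0, by rw [hf, map_zero]⟩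
  · intro hξ α hα hne
    obtain ⟨P, hP, x, hx, hPx⟩ := Y.exists_eval_ne_zero hne
    refine hξ α _ hP ?_
    rintro ⟨c, hc⟩
    change Ideal.Quotient.mk Y.ideal (MvPolynomial.C c) = _ at hc
    have hval {y : Fin N → ℂ} (hy : y ∈ Y.points) : MvPolynomial.eval y P = c := by
      have := Y.mem_points_iff.1 hy _ (Ideal.Quotient.eq.1 hc)
      rw [map_sub, MvPolynomial.eval_C, sub_eq_zero] at this
      exact this.symm
    have hlim := tendsto_eval_complexFlow (hr.pairing_weight_pos hξ₀ hξ₀) x P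
    rw [eval_zero_of_mem_weightSpace (hr.pairing_weight_pos hξ₀ hξ₀) (hξ₀ α hα hne) hP hx] at hlim
    simp only [hval (Y.complexFlow_mem_points ξ₀ _ hx)] at hlim
    rw [hval hx] at hPx
    exact hPx (tendsto_nhds_unique tendsto_const_nhds hlim)

/-! ### Comparison of the radius with a homogeneous gauge -/

variable (Y) in
/-- The gauge `max |xᵢ| ^ (1 / aᵢ)`, where `aᵢ` is the weight of `xᵢ` under `ξ`. For positive
weights it is the simplest function that `complexFlow ξ τ` scales by `exp τ`. -/
noncomputable def gauge (ξ : Fin s → ℝ) (x : Fin N → ℂ) : ℝ :=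
  ‖fun i => ‖x i‖ ^ (pairing (Y.weight i) ξ)⁻¹‖

theorem continuous_gauge (h : ∀ i, 0 < pairing (Y.weight i) ξ) : Continuous (Y.gauge ξ) := by
  refine Continuous.norm (continuous_pi fun i => ?_)
  exact (continuous_apply i).norm.rpow_const fun _ => Or.inr (inv_pos.2 (h i)).le

theorem gauge_zero (h : ∀ i, 0 < pairing (Y.weight i) ξ) : Y.gauge ξ 0 = 0 := by
  rw [gauge, norm_eq_zero]
  funext i
  simp [Real.zero_rpow (inv_pos.2 (h i)).ne']

theorem gauge_complexFlow (h : ∀ i, 0 < pairing (Y.weight i) ξ) (τ : ℝ) (x : Fin N → ℂ) :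
    Y.gauge ξ (Y.complexFlow ξ τ x) = Real.exp τ * Y.gauge ξ x := by
  have : (fun i => ‖Y.complexFlow ξ τ x i‖ ^ (pairing (Y.weight i) ξ)⁻¹) =
      Real.exp τ • fun i => ‖x i‖ ^ (pairing (Y.weight i) ξ)⁻¹ := by
    funext i
    have hnorm : ‖Complex.exp (τ * pairing (Y.weight i) ξ)‖ =
        Real.exp (τ * pairing (Y.weight i) ξ) := by
      rw [Complex.norm_exp]
      simp
    rw [complexFlow, norm_mul, hnorm, Real.mul_rpow (Real.exp_pos _).le (norm_nonneg _),
      ← Real.exp_mul, mul_inv_cancel_right₀ (h i).ne', Pi.smul_apply, smul_eq_mul]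
  rw [gauge, this, norm_smul, Real.norm_of_nonneg (Real.exp_pos τ).le, gauge]

theorem norm_apply_le_gauge_rpow (h : ∀ i, 0 < pairing (Y.weight i) ξ) (x : Fin N → ℂ)
    (i : Fin N) : ‖x i‖ ≤ Y.gauge ξ x ^ pairing (Y.weight i) ξ := by
  have h1 : ‖x i‖ ^ (pairing (Y.weight i) ξ)⁻¹ ≤ Y.gauge ξ x := by
    refine le_trans (le_abs_self _) ?_
    exact norm_le_pi_norm (fun i => ‖x i‖ ^ (pairing (Y.weight i) ξ)⁻¹) i
  calc ‖x i‖ = (‖x i‖ ^ (pairing (Y.weight i) ξ)⁻¹) ^ pairing (Y.weight i) ξ := by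
        rw [Real.rpow_inv_rpow (norm_nonneg _) (h i).ne']
    _ ≤ _ := Real.rpow_le_rpow (Real.rpow_nonneg (norm_nonneg _) _) h1 (h i).le

theorem gauge_pos (h : ∀ i, 0 < pairing (Y.weight i) ξ) {x : Fin N → ℂ} (hx : x ≠ 0) :
    0 < Y.gauge ξ x := by
  refine (norm_nonneg _).lt_of_ne' fun h0 => hx ?_
  funext i
  have := norm_apply_le_gauge_rpow h x i
  rw [gauge, h0, Real.zero_rpow (h i).ne'] at this
  exact norm_le_zero_iff.1 this

variable (Y) in
/-- The points of `Y` of gauge `1`, a compact cross-section of the flow on `Y ∖ {0}`. -/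
def gaugeSphere (ξ : Fin s → ℝ) : Set (Fin N → ℂ) :=
  {x ∈ Y.points | Y.gauge ξ x = 1}

theorem isCompact_gaugeSphere (h : ∀ i, 0 < pairing (Y.weight i) ξ) :
    IsCompact (Y.gaugeSphere ξ) := by
  refine Metric.isCompact_of_isClosed_isBounded
    (Y.isClosed_points.inter (isClosed_eq (continuous_gauge h) continuous_const)) ?_
  refine (Metric.isBounded_closedBall (x := (0 : Fin N → ℂ)) (r := 1)).subset ?_
  intro x hx
  rw [mem_closedBall_zero_iff, pi_norm_le_iff_of_nonneg zero_le_one]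
  intro i
  have := norm_apply_le_gauge_rpow h x i
  rwa [hx.2, Real.one_rpow] at this

theorem gaugeSphere_subset (h : ∀ i, 0 < pairing (Y.weight i) ξ) :
    Y.gaugeSphere ξ ⊆ Y.puncturedPoints := by
  refine fun x hx => ⟨hx.1, fun h0 => ?_⟩
  have := hx.2
  rw [Set.mem_singleton_iff.1 h0, gauge_zero h] at this
  exact zero_ne_one this

theorem exists_mem_gaugeSphere (h : ∀ i, 0 < pairing (Y.weight i) ξ) {x : Fin N → ℂ}
    (hx : x ∈ Y.puncturedPoints) :
    ∃ u ∈ Y.gaugeSphere ξ, Y.complexFlow ξ (Real.log (Y.gauge ξ x)) u = x := by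
  refine ⟨Y.complexFlow ξ ((-Real.log (Y.gauge ξ x) : ℝ) : ℂ) x,
    ⟨Y.complexFlow_mem_points _ _ hx.1, ?_⟩, ?_⟩
  · rw [gauge_complexFlow h, Real.exp_neg, Real.exp_log (gauge_pos h hx.2)]
    exact inv_mul_cancel₀ (gauge_pos h hx.2).ne'
  · rw [← complexFlow_add]
    simp

theorem IsCompatible.hasDerivAt_comp_complexFlow (hr : Y.IsCompatible ξ₀ r) (ξ : Fin s → ℝ)
    {x : Fin N → ℂ} (hx : x ∈ Y.puncturedPoints) (t : ℝ) :
    HasDerivAt (fun τ : ℝ => r (Y.complexFlow ξ τ x))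
      (fderiv ℝ r (Y.complexFlow ξ t x) (Y.radialField ξ (Y.complexFlow ξ t x))) t :=
  (((hr.smooth _ (Y.complexFlow_mem_puncturedPoints ξ t hx)).differentiableAt
    (by simp)).hasFDerivAt).comp_hasDerivAt t (Y.hasDerivAt_complexFlow_real ξ x t)

/-- The radius is homogeneous of degree one under the flow of the radial field. -/
theorem IsCompatible.apply_complexFlow (hr : Y.IsCompatible ξ₀ r) {x : Fin N → ℂ}
    (hx : x ∈ Y.puncturedPoints) (τ : ℝ) :
    r (Y.complexFlow ξ₀ τ x) = Real.exp τ * r x := by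
  have hderiv (t : ℝ) :
      HasDerivAt (fun τ : ℝ => Real.exp (-τ) * r (Y.complexFlow ξ₀ τ x)) 0 t := by
    have h1 := hr.hasDerivAt_comp_complexFlow ξ₀ hx t
    rw [← neg_I_smul_vectorField,
      hr.radial _ (Y.complexFlow_mem_puncturedPoints ξ₀ t hx)] at h1
    refine ((hasDerivAt_neg t).exp.mul h1).congr_deriv ?_
    ring
  have h := is_const_of_deriv_eq_zero (fun t => (hderiv t).differentiableAt)
    (fun t => (hderiv t).deriv) τ 0
  simp only [neg_zero, Real.exp_zero, Complex.ofReal_zero, complexFlow_zero, one_mul] at h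
  rw [← h, ← mul_assoc, ← Real.exp_add, add_neg_cancel, Real.exp_zero, one_mul]

theorem IsCompatible.continuousOn (hr : Y.IsCompatible ξ₀ r) :
    ContinuousOn r Y.puncturedPoints :=
  fun p hp => (hr.smooth p hp).continuousAt.continuousWithinAt

/-- The radius and the gauge are both homogeneous of degree one, hence comparable. -/
theorem IsCompatible.exists_gauge_bounds (hr : Y.IsCompatible ξ₀ r)
    (h : ∀ i, 0 < pairing (Y.weight i) ξ₀) :
    ∃ c C : ℝ, 0 < c ∧ ∀ x ∈ Y.puncturedPoints,
      c * Y.gauge ξ₀ x ≤ r x ∧ r x ≤ C * Y.gauge ξ₀ x := by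
  have hK := isCompact_gaugeSphere h
  have hcont := hr.continuousOn.mono (gaugeSphere_subset h)
  obtain ⟨c, hc, hcle⟩ := hK.exists_forall_le' hcont fun p hp =>
    hr.pos p (gaugeSphere_subset h hp)
  obtain ⟨C, hC⟩ := hK.bddAbove_image hcont
  refine ⟨c, C, hc, fun x hx => ?_⟩
  obtain ⟨u, hu, hux⟩ := exists_mem_gaugeSphere h hx
  have hx_eq : r x = Y.gauge ξ₀ x * r u := by
    conv_lhs => rw [← hux]
    rw [hr.apply_complexFlow (gaugeSphere_subset h hu), Real.exp_log (gauge_pos h hx.2)]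
  have hpos := (gauge_pos h hx.2).le
  rw [hx_eq, mul_comm c, mul_comm C]
  exact ⟨mul_le_mul_of_nonneg_left (hcle u hu) hpos,
    mul_le_mul_of_nonneg_left (hC ⟨u, hu, rfl⟩) hpos⟩

/-! ### The contact form on the Lie algebra -/

/-- `η₀(ξ) = d log r (-J ξ)`. -/
theorem IsCompatible.contactForm_vectorField (hr : Y.IsCompatible ξ₀ r) (ξ : Fin s → ℝ)
    {x : Fin N → ℂ} (hx : x ∈ Y.puncturedPoints) :
    Y.contactForm ξ₀ r x (Y.vectorField ξ x) = fderiv ℝ r x (Y.radialField ξ x) / r x := by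
  have hpos := (hr.pos x hx).ne'
  rw [contactForm, ← kahlerMetric_neg_I_smul, neg_I_smul_vectorField Y ξ,
    hr.gradient x hx _ (Y.radialField_mem_tangentSpace ξ hx.1)]
  field_simp

theorem IsCompatible.mem_contactReebCone_iff (hr : Y.IsCompatible ξ₀ r) :
    ξ ∈ Y.contactReebCone ξ₀ r ↔
      ∀ x ∈ Y.puncturedPoints, 0 < fderiv ℝ r x (Y.radialField ξ x) := by
  refine forall₂_congr fun x hx => ?_
  rw [hr.contactForm_vectorField ξ hx, div_pos_iff_of_pos_right (hr.pos x hx)]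

/-- `dr(-J ξ)` is homogeneous of degree one, because the flows of `ξ₀` and `ξ` commute. -/
theorem IsCompatible.fderiv_radialField_complexFlow (hr : Y.IsCompatible ξ₀ r) (ξ : Fin s → ℝ)
    {x : Fin N → ℂ} (hx : x ∈ Y.puncturedPoints) (τ : ℝ) :
    fderiv ℝ r (Y.complexFlow ξ₀ τ x) (Y.radialField ξ (Y.complexFlow ξ₀ τ x)) =
      Real.exp τ * fderiv ℝ r x (Y.radialField ξ x) := by
  have h1 := hr.hasDerivAt_comp_complexFlow ξ (Y.complexFlow_mem_puncturedPoints ξ₀ τ hx) 0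
  have h2 := (hr.hasDerivAt_comp_complexFlow ξ hx 0).const_mul (Real.exp τ)
  simp only [Complex.ofReal_zero, complexFlow_zero] at h1 h2
  refine h1.unique (h2.congr_of_eventuallyEq (Eventually.of_forall fun σ => ?_))
  change r (Y.complexFlow ξ σ (Y.complexFlow ξ₀ τ x)) = Real.exp τ * r (Y.complexFlow ξ σ x)
  rw [complexFlow_comm, hr.apply_complexFlow (Y.complexFlow_mem_puncturedPoints ξ σ hx)]

theorem continuous_radialField (ξ : Fin s → ℝ) : Continuous (Y.radialField ξ) :=
  continuous_pi fun i => continuous_const.mul (continuous_apply i)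

/-- If `η₀(ξ)` is positive then it is bounded below by a positive constant, by compactness of a
cross-section of the radial flow. -/
theorem IsCompatible.exists_forall_mul_le_fderiv (hr : Y.IsCompatible ξ₀ r)
    (h : ∀ i, 0 < pairing (Y.weight i) ξ₀) (hξ : ξ ∈ Y.contactReebCone ξ₀ r) :
    ∃ δ > 0, ∀ x ∈ Y.puncturedPoints, δ * r x ≤ fderiv ℝ r x (Y.radialField ξ x) := by
  rw [hr.mem_contactReebCone_iff] at hξ
  have hcont : ContinuousOn (fun x => fderiv ℝ r x (Y.radialField ξ x) / r x)
      (Y.gaugeSphere ξ₀) := by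
    intro x hx
    have hx' := gaugeSphere_subset h hx
    have h1 : ContinuousAt (fderiv ℝ r) x :=
      ((hr.smooth x hx').fderiv_right (m := 0) (by simp)).continuousAt
    exact ((h1.clm_apply (continuous_radialField ξ).continuousAt).div
      (hr.smooth x hx').continuousAt (hr.pos x hx').ne').continuousWithinAt
  obtain ⟨δ, hδ, hle⟩ := (isCompact_gaugeSphere h).exists_forall_le' hcont fun x hx =>
    div_pos (hξ x (gaugeSphere_subset h hx)) (hr.pos x (gaugeSphere_subset h hx))
  refine ⟨δ, hδ, fun x hx => ?_⟩
  obtain ⟨u, hu, hux⟩ := exists_mem_gaugeSphere h hx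
  have hu' := gaugeSphere_subset h hu
  rw [← hux, hr.apply_complexFlow hu', hr.fderiv_radialField_complexFlow ξ hu', mul_left_comm]
  exact mul_le_mul_of_nonneg_left ((le_div_iff₀ (hr.pos u hu')).1 (hle u hu))
    (Real.exp_pos _).le

/-- If `η₀(ξ)` is positive then `r` decays exponentially along the backward flow of `-J ξ`. -/
theorem IsCompatible.tendsto_apply_complexFlow (hr : Y.IsCompatible ξ₀ r)
    (h : ∀ i, 0 < pairing (Y.weight i) ξ₀) (hξ : ξ ∈ Y.contactReebCone ξ₀ r) {x : Fin N → ℂ}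
    (hx : x ∈ Y.puncturedPoints) :
    Tendsto (fun τ : ℝ => r (Y.complexFlow ξ τ x)) atBot (𝓝 0) := by
  obtain ⟨δ, hδ, hle⟩ := hr.exists_forall_mul_le_fderiv h hξ
  have hderiv (t : ℝ) := ((hasDerivAt_mul_const (x := t) (-δ)).exp.mul
    (hr.hasDerivAt_comp_complexFlow ξ hx t))
  have hmono := monotone_of_deriv_nonneg (fun t => (hderiv t).differentiableAt) fun t => by
    rw [(hderiv t).deriv]
    have := mul_le_mul_of_nonneg_left
      (hle _ (Y.complexFlow_mem_puncturedPoints ξ t hx)) (Real.exp_pos (t * -δ)).le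
    linarith
  have hlim : Tendsto (fun τ : ℝ => Real.exp (τ * δ) * r x) atBot (𝓝 0) := by
    simpa using (Real.tendsto_exp_atBot.comp (tendsto_id.atBot_mul_const hδ)).mul_const (r x)
  refine squeeze_zero' (Eventually.of_forall fun τ =>
    (hr.pos _ (Y.complexFlow_mem_puncturedPoints ξ τ hx)).le) ?_ hlim
  filter_upwards [eventually_le_atBot 0] with τ hτ
  have h0 := hmono hτ
  simp only [Pi.mul_apply, zero_mul, Real.exp_zero, Complex.ofReal_zero, complexFlow_zero,
    one_mul] at h0
  have h1 := mul_le_mul_of_nonneg_left h0 (Real.exp_pos (τ * δ)).le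
  rwa [← mul_assoc, ← Real.exp_add, mul_neg, add_neg_cancel, Real.exp_zero, one_mul] at h1

theorem IsCompatible.tendsto_zero_of_apply_tendsto_zero (hr : Y.IsCompatible ξ₀ r)
    (h : ∀ i, 0 < pairing (Y.weight i) ξ₀) {ι : Type*} {l : Filter ι} {q : ι → Fin N → ℂ}
    (hq : ∀ j, q j ∈ Y.puncturedPoints) (hlim : Tendsto (fun j => r (q j)) l (𝓝 0)) :
    Tendsto q l (𝓝 0) := by
  obtain ⟨c, C, hc, hbd⟩ := hr.exists_gauge_bounds h
  have hgauge : Tendsto (fun j => Y.gauge ξ₀ (q j)) l (𝓝 0) := by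
    refine squeeze_zero (fun j => norm_nonneg _) (fun j => ?_)
      (by simpa using hlim.div_const c)
    rw [le_div_iff₀ hc, mul_comm]
    exact (hbd _ (hq j)).1
  rw [tendsto_pi_nhds]
  intro i
  refine squeeze_zero_norm (fun j => norm_apply_le_gauge_rpow h (q j) i) ?_
  simpa [Real.zero_rpow (h i).ne'] using hgauge.rpow_const (Or.inr (h i).le)

theorem IsCompatible.contactReebCone_subset (hr : Y.IsCompatible ξ₀ r) (hξ₀ : Y.IsReeb ξ₀) :
    Y.contactReebCone ξ₀ r ⊆ Y.reebCone := by
  intro ξ hξ α hα hne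
  have h := hr.pairing_weight_pos hξ₀ hξ₀
  obtain ⟨P, hP, x, hx, hPx⟩ := Y.exists_eval_ne_zero hne
  have hP0 := eval_zero_of_mem_weightSpace h (hξ₀ α hα hne) hP hx
  have hx' : x ∈ Y.puncturedPoints := by
    refine ⟨hx, fun h0 => hPx ?_⟩
    rw [Set.mem_singleton_iff.1 h0, hP0]
  have hflow := hr.tendsto_zero_of_apply_tendsto_zero h
    (fun τ : ℝ => Y.complexFlow_mem_puncturedPoints ξ τ hx')
    (hr.tendsto_apply_complexFlow h hξ hx')
  have hlim := ((MvPolynomial.continuous_eval P).tendsto 0).comp hflow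
  rw [hP0] at hlim
  by_contra! hneg
  -- for `α(ξ) ≤ 0` the modulus of the weight vector does not decrease along the backward flow
  have hge : ‖MvPolynomial.eval x P‖ ≤ ‖(0 : ℂ)‖ := by
    refine ge_of_tendsto hlim.norm ?_
    filter_upwards [eventually_le_atBot 0] with τ hτ
    rw [Function.comp_apply, Y.eval_complexFlow_of_mem_weightSpace hP ξ _ hx, norm_mul,
      Complex.norm_exp]
    refine le_mul_of_one_le_left (norm_nonneg _) (Real.one_le_exp ?_)
    simpa using mul_nonneg_of_nonpos_of_nonpos hτ hneg
  rw [norm_zero] at hge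
  exact hPx (norm_le_zero_iff.1 hge)

/-! ### Convexity along the flow lines of a Reeb vector field -/

theorem IsCompatible.hasDerivAt_sq_comp_complexFlow (hr : Y.IsCompatible ξ₀ r) (ξ : Fin s → ℝ)
    (a : ℂ) {x : Fin N → ℂ} (hx : x ∈ Y.puncturedPoints) (t : ℝ) :
    HasDerivAt (fun τ : ℝ => r (Y.complexFlow ξ (a * τ) x) ^ 2)
      (fderiv ℝ (fun y => r y ^ 2) (Y.complexFlow ξ (a * t) x)
        (a • Y.radialField ξ (Y.complexFlow ξ (a * t) x))) t := by
  have h : DifferentiableAt ℝ (fun y => r y ^ 2) (Y.complexFlow ξ (a * t) x) :=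
    ((hr.smooth _ (Y.complexFlow_mem_puncturedPoints ξ (a * t) hx)).pow 2).differentiableAt
      (by simp)
  exact h.hasFDerivAt.comp_hasDerivAt t (Y.hasDerivAt_complexFlow ξ a x t)

theorem IsCompatible.hasDerivAt_fderiv_sq_comp_complexFlow (hr : Y.IsCompatible ξ₀ r)
    (ξ : Fin s → ℝ) (a : ℂ) {x : Fin N → ℂ} (hx : x ∈ Y.puncturedPoints) (t : ℝ) :
    HasDerivAt (fun τ : ℝ => fderiv ℝ (fun y => r y ^ 2) (Y.complexFlow ξ (a * τ) x)
        (a • Y.radialField ξ (Y.complexFlow ξ (a * τ) x)))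
      (fderiv ℝ (fderiv ℝ fun y => r y ^ 2) (Y.complexFlow ξ (a * t) x)
          (a • Y.radialField ξ (Y.complexFlow ξ (a * t) x))
          (a • Y.radialField ξ (Y.complexFlow ξ (a * t) x)) +
        fderiv ℝ (fun y => r y ^ 2) (Y.complexFlow ξ (a * t) x)
          (a • a • Y.radialField ξ (Y.radialField ξ (Y.complexFlow ξ (a * t) x)))) t := by
  have h1 := (((((hr.smooth _ (Y.complexFlow_mem_puncturedPoints ξ (a * t) hx)).pow 2).fderiv_right
    (m := ∞) (by simp)).differentiableAt (by simp)).hasFDerivAt).comp_hasDerivAt t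
      (Y.hasDerivAt_complexFlow ξ a x t)
  exact h1.clm_apply ((Y.hasDerivAt_radialField_complexFlow ξ a x t).const_smul a)

/-- The second derivative of `r²` along the flow of `-J ξ` is `4 g(-J ξ, -J ξ)`: it is the
Laplacian of `r²` along the complex orbit of `ξ`, since `r²` does not depend on imaginary time. -/
theorem IsCompatible.hessian_sq_radialField (hr : Y.IsCompatible ξ₀ r)
    (hT : Y.IsTorusInvariant r) (ξ : Fin s → ℝ) {x : Fin N → ℂ} (hx : x ∈ Y.puncturedPoints) :
    fderiv ℝ (fderiv ℝ fun y => r y ^ 2) x (Y.radialField ξ x) (Y.radialField ξ x) +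
        fderiv ℝ (fun y => r y ^ 2) x (Y.radialField ξ (Y.radialField ξ x)) =
      4 * kahlerMetric r x (Y.radialField ξ x) (Y.radialField ξ x) := by
  have hconst (θ : ℝ) : fderiv ℝ (fun y => r y ^ 2) (Y.complexFlow ξ (Complex.I * θ) x)
      (Complex.I • Y.radialField ξ (Y.complexFlow ξ (Complex.I * θ) x)) = 0 := by
    refine (hr.hasDerivAt_sq_comp_complexFlow ξ Complex.I hx θ).unique ?_
    simp only [← expAction_smul, hT x hx]
    exact hasDerivAt_const θ _
  have h := hr.hasDerivAt_fderiv_sq_comp_complexFlow ξ Complex.I hx 0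
  simp only [hconst] at h
  have h0 := h.unique (hasDerivAt_const 0 0)
  simp only [Complex.ofReal_zero, mul_zero, complexFlow_zero] at h0
  rw [smul_smul, Complex.I_mul_I, neg_one_smul, map_neg] at h0
  rw [kahlerMetric_eq]
  linarith

theorem IsCompatible.kahlerMetric_radialField_nonneg (hr : Y.IsCompatible ξ₀ r) (ξ : Fin s → ℝ)
    {x : Fin N → ℂ} (hx : x ∈ Y.puncturedPoints) :
    0 ≤ kahlerMetric r x (Y.radialField ξ x) (Y.radialField ξ x) := by
  by_cases h0 : Y.radialField ξ x = 0
  · simp [h0, kahlerMetric_eq]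
  · exact (hr.kahler x hx _ (Y.radialField_mem_tangentSpace ξ hx.1) h0).le

theorem IsCompatible.reebCone_subset (hr : Y.IsCompatible ξ₀ r) (hT : Y.IsTorusInvariant r)
    (hξ₀ : Y.IsReeb ξ₀) : Y.reebCone ⊆ Y.contactReebCone ξ₀ r := by
  intro ξ hξ
  rw [hr.mem_contactReebCone_iff]
  intro x hx
  have h := hr.pairing_weight_pos hξ₀ hξ₀
  have hF (t : ℝ) := hr.hasDerivAt_sq_comp_complexFlow ξ 1 hx t
  have hF' (t : ℝ) := hr.hasDerivAt_fderiv_sq_comp_complexFlow ξ 1 hx t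
  simp only [one_mul, one_smul] at hF hF'
  have hmono := monotone_of_deriv_nonneg (fun t => (hF' t).differentiableAt) fun t => by
    have hxt := Y.complexFlow_mem_puncturedPoints ξ t hx
    rw [(hF' t).deriv, hr.hessian_sq_radialField hT ξ hxt]
    linarith [hr.kahlerMetric_radialField_nonneg ξ hxt]
  have hd0 : fderiv ℝ (fun y => r y ^ 2) x (Y.radialField ξ x) =
      2 * r x * fderiv ℝ r x (Y.radialField ξ x) := by
    have h1 := hF 0
    have h2 := (hr.hasDerivAt_comp_complexFlow ξ hx 0).pow 2
    simp only [Complex.ofReal_zero, complexFlow_zero] at h1 h2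
    simpa using h1.unique h2
  by_contra! hneg
  -- a convex function with nonpositive slope at `0` is bounded below by its value there
  have hanti : AntitoneOn (fun τ : ℝ => r (Y.complexFlow ξ τ x) ^ 2) (Set.Iic 0) := by
    refine antitoneOn_of_deriv_nonpos (convex_Iic 0)
      (fun t _ => (hF t).continuousAt.continuousWithinAt)
      (fun t _ => (hF t).differentiableAt.differentiableWithinAt) fun t ht => ?_
    rw [(hF t).deriv]
    refine (hmono (Set.mem_Iic.1 (interior_subset ht))).trans ?_
    simp only [Complex.ofReal_zero, complexFlow_zero, hd0]
    exact mul_nonpos_of_nonneg_of_nonpos (by linarith [hr.pos x hx]) hneg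
  obtain ⟨c, C, hc, hbd⟩ := hr.exists_gauge_bounds h
  have hgauge : Tendsto (fun τ : ℝ => C * Y.gauge ξ₀ (Y.complexFlow ξ τ x)) atBot (𝓝 0) := by
    have := (((continuous_gauge h).tendsto 0).comp (Y.tendsto_complexFlow_atBot_zero
      (hr.pairing_weight_pos hξ₀ hξ) x)).const_mul C
    rwa [gauge_zero h, mul_zero] at this
  have hlim : Tendsto (fun τ : ℝ => r (Y.complexFlow ξ τ x)) atBot (𝓝 0) :=
    squeeze_zero (fun τ => (hr.pos _ (Y.complexFlow_mem_puncturedPoints ξ τ hx)).le)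
      (fun τ => (hbd _ (Y.complexFlow_mem_puncturedPoints ξ τ hx)).2) hgauge
  have hle : r x ^ 2 ≤ 0 ^ 2 := by
    refine ge_of_tendsto (hlim.pow 2) ?_
    filter_upwards [eventually_le_atBot 0] with τ hτ
    simpa using hanti (Set.mem_Iic.2 hτ) (Set.mem_Iic.2 le_rfl) hτ
  have := pow_pos (hr.pos x hx) 2
  linarith

end TorusVariety

end ReebCone

theorem proposition2p5 {N s : ℕ} (Y : ReebCone.TorusVariety N s)
    (ξ₀ : Fin s → ℝ) (hξ₀ : Y.IsReeb ξ₀) (hrat : Y.IsRational ξ₀)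
    (r : (Fin N → ℂ) → ℝ) (hr : Y.IsCompatible ξ₀ r) (hT : Y.IsTorusInvariant r) :
    Y.contactReebCone ξ₀ r = Y.reebCone ∧ Y.reebCone = Y.positiveWeightCone :=
  ⟨(hr.contactReebCone_subset hξ₀).antisymm (hr.reebCone_subset hT hξ₀),
    ReebCone.TorusVariety.reebCone_eq_positiveWeightCone hr hξ₀⟩
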